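/- There is a function $C:[0,\infty)\to\mathbb{R}$ such that the following holds. Let $\Omega\subset\mathbb{R}$ be a bounded interval of length $|\Omega|$, let $N\ge 1$, let $x_1,\dots,x_N\in\mathbb{R}$ be pairwise distinct, let $\mu_N=\frac1N\sum_{i=1}^N\delta_{x_i}$, and let $\varepsilon>0$. Let $\sigma_N$ be a minimizer of $$\rho\longmapsto \frac1{2\varepsilon}W_2^2(\mu_N,\rho)+\mathrm{Ent}(\rho)$$ over the set $\mathrm{Prob}(\Omega)$ of probability measures on $\Omega$, where $W_2$ is the quadratic Wasserstein distance, and $\mathrm{Ent}(\rho)=\int_\Omega \log\rho\,\mathrm{d}\rho$ if $\rho$ is absolutely continuous with respect to the Lebesgue measure on $\Omega$ (its density being also denoted by $\rho$) and $\mathrm{Ent}(\rho)=+\infty$ otherwise. Let $T$ be an optimal transport map from $\sigma_N$ to $\mu_N$ for the quadratic cost, let $L_i=\{y\in\Omega : T(y)=x_i\}$ be the Laguerre cells of $\sigma_N$, and let $\beta_i=\frac{1}{\sigma_N(L_i)}\int_{L_i}y\,\mathrm{d}\sigma_N(y)$ be their barycenters, where $\sigma_N(L_i)=\frac1N$. Then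 $$W_2^2\Bigl(\sigma_N,\frac1N\sum_{i=1}^N\delta_{\beta_i}\Bigr)\le C(|\Omega|)\,\frac{\sqrt{\varepsilon}}{N}.$$ -/

import Mathlib

open MeasureTheory
open scoped ENNReal

noncomputable section

/-- Transport plans (couplings) between two measures on the real line. -/
def transportPlans (μ ν : Measure ℝ) : Set (Measure (ℝ × ℝ)) :=
  {γ | γ.map Prod.fst = μ ∧ γ.map Prod.snd = ν}

/-- The squared Wasserstein distance `W₂²(μ, ν)`: the infimum of `∫ |y - z|² dγ(y, z)` over all
transport plans `γ` between `μ` and `ν`, with values in `[0, ∞]`. -/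
def W2sq (μ ν : Measure ℝ) : ℝ≥0∞ :=
  ⨅ γ ∈ transportPlans μ ν, ∫⁻ p, edist p.1 p.2 ^ 2 ∂γ

/-- The uniform atomic measure `(1/N) ∑ᵢ δ_{xᵢ}`. -/
def atomicMeasure {N : ℕ} (x : Fin N → ℝ) : Measure ℝ :=
  (N : ℝ≥0∞)⁻¹ • ∑ i, Measure.dirac (x i)

/-- `Prob(Ω)`: the probability measures on the line that are concentrated on `Ω`. -/
def probOn (Ω : Set ℝ) : Set (Measure ℝ) :=
  {ρ | IsProbabilityMeasure ρ ∧ ρ Ωᶜ = 0}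

open scoped Classical in
/-- The entropy `Ent(ρ) = ∫_Ω log ρ dρ` when `ρ` has a density with respect to Lebesgue measure on
`Ω`, and `+∞` otherwise. Since `r log r ≥ -1/e`, the negative part of the integral is finite for
`ρ` in `Prob(Ω)` when `Ω` is bounded, so that a non-integrable `log ρ` means that the integral
is `+∞`. -/
def Ent (Ω : Set ℝ) (ρ : Measure ℝ) : EReal :=
  if ρ ≪ volume.restrict Ω ∧
      Integrable (fun y => Real.log (ρ.rnDeriv (volume.restrict Ω) y).toReal) ρ
  then ((∫ y, Real.log (ρ.rnDeriv (volume.restrict Ω) y).toReal ∂ρ : ℝ) : EReal)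
  else ⊤

/-- The functional `ρ ↦ W₂²(μ, ρ) / (2ε) + Ent(ρ)`. -/
def penalizedEnt (Ω : Set ℝ) (ε : ℝ) (μ ρ : Measure ℝ) : EReal :=
  ((ENNReal.ofReal (1 / (2 * ε)) * W2sq μ ρ : ℝ≥0∞) : EReal) + Ent Ω ρ

/-- `σ` is a minimizer over `Prob(Ω)` of `ρ ↦ W₂²(μ, ρ) / (2ε) + Ent(ρ)`. -/
def IsEntMinimizer (Ω : Set ℝ) (ε : ℝ) (μ σ : Measure ℝ) : Prop :=
  σ ∈ probOn Ω ∧ ∀ ρ ∈ probOn Ω, penalizedEnt Ω ε μ σ ≤ penalizedEnt Ω ε μ ρ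

/-- `T` is an optimal transport map from `σ` to `μ` for the quadratic cost. -/
def IsOptimalMap (σ μ : Measure ℝ) (T : ℝ → ℝ) : Prop :=
  Measurable T ∧ σ.map T = μ ∧ ∫⁻ y, edist y (T y) ^ 2 ∂σ = W2sq σ μ

/-- The Laguerre cell of the point `z`: the part of `Ω` that `T` sends to `z`. -/
def laguerreCell (Ω : Set ℝ) (T : ℝ → ℝ) (z : ℝ) : Set ℝ :=
  {y ∈ Ω | T y = z}

/-- The barycenter `(∫_L y dσ(y)) / σ(L)` of the set `L` with respect to `σ`. -/
def cellBarycenter (σ : Measure ℝ) (L : Set ℝ) : ℝ :=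
  (∫ y in L, y ∂σ) / (σ L).toReal

end

/-! On the line, optimal cells are ordered like the points `x i`, so up to null sets they are the
traces of disjoint intervals `H i ⊆ Ω`. Sending each cell to its barycenter costs at most the sum of
the `V i = ∫ (y - β i)² dσ` over the cells, and each `V i` has two bounds.

The trivial one is `V i ≤ |H i|² / N`, since the barycenter lies in the closure of `H i`. The other
comes from minimality: contract `H i` by `1/2` towards `β i` and keep the rest of `σ`. Since `β i`
is the barycenter, the cross term vanishes and the transport cost drops by at least `3/4 * V i`; the
density doubles on a mass `1/N`, so the entropy rises by `log 2 / N`. Hence `V i ≤ 2ε / N`, because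
`log 2 < 3/4`.

Together, `V i ≤ 2 √ε |H i| / N`. This is linear in `|H i|`, and the disjoint lengths sum to at most
`|Ω|`, so `C(l) = 2l` works.

The carrying lemmas are `measure_inter_Ici_eq_zero_or` (ordering of the cells),
`Ent_map_halfContraction` (entropy of the competitor) and `setIntegral_sq_le_of_isEntMinimizer` (the
bound by `ε`). -/

/-! ### Couplings and the quadratic cost -/

section Transport

variable {α : Type*} [MeasurableSpace α]

/-- Two maps out of a common space give a transport plan between their laws. -/
theorem W2sq_map_map_le (P : Measure α) {a b : α → ℝ} (ha : Measurable a) (hb : Measurable b) :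
    W2sq (P.map a) (P.map b) ≤ ∫⁻ p, edist (a p) (b p) ^ 2 ∂P := by
  have hab : Measurable fun p => (a p, b p) := ha.prodMk hb
  have hmem : P.map (fun p => (a p, b p)) ∈ transportPlans (P.map a) (P.map b) := by
    refine ⟨?_, ?_⟩
    · rw [Measure.map_map measurable_fst hab]; rfl
    · rw [Measure.map_map measurable_snd hab]; rfl
  refine (iInf₂_le _ hmem).trans_eq ?_
  rw [lintegral_map (by fun_prop) hab]

theorem W2sq_le_swap (μ ν : Measure ℝ) : W2sq μ ν ≤ W2sq ν μ := by
  refine le_iInf₂ fun γ hγ => ?_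
  have := W2sq_map_map_le γ measurable_snd measurable_fst
  rw [hγ.1, hγ.2] at this
  exact this.trans_eq (lintegral_congr fun p => by rw [edist_comm])

theorem W2sq_comm (μ ν : Measure ℝ) : W2sq μ ν = W2sq ν μ :=
  le_antisymm (W2sq_le_swap μ ν) (W2sq_le_swap ν μ)

theorem edist_sq_eq_ofReal (a b : ℝ) : edist a b ^ 2 = ENNReal.ofReal ((a - b) ^ 2) := by
  rw [edist_dist, ← ENNReal.ofReal_pow dist_nonneg, Real.dist_eq, sq_abs]

theorem lintegral_edist_sq_eq_ofReal {P : Measure α} {a b : α → ℝ}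
    (h : Integrable (fun p => (a p - b p) ^ 2) P) :
    ∫⁻ p, edist (a p) (b p) ^ 2 ∂P = ENNReal.ofReal (∫ p, (a p - b p) ^ 2 ∂P) := by
  rw [ofReal_integral_eq_lintegral_ofReal h (.of_forall fun p => sq_nonneg _)]
  exact lintegral_congr fun p => edist_sq_eq_ofReal _ _

end Transport

/-! ### Labels in `Fin N` in place of atoms -/

section Labels

/-- The uniform measure on `Fin N`. -/
noncomputable def uniformLabel (N : ℕ) : Measure (Fin N) :=
  (N : ℝ≥0∞)⁻¹ • ∑ i, Measure.dirac i

theorem uniformLabel_singleton {N : ℕ} (i : Fin N) : uniformLabel N {i} = (N : ℝ≥0∞)⁻¹ := by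
  simp [uniformLabel, Measure.finsetSum_apply, Set.indicator]

theorem uniformLabel_map {N : ℕ} (z : Fin N → ℝ) :
    (uniformLabel N).map z = atomicMeasure z := by
  have hz : Measurable z := measurable_of_finite z
  ext s hs
  simp [uniformLabel, atomicMeasure, Measure.map_apply hz hs, Measure.finsetSum_apply, hs,
    Set.indicator]
  rfl

theorem atomicMeasure_map {N : ℕ} (x : Fin N → ℝ) {g : ℝ → Fin N} (hg : Measurable g)
    (hgx : ∀ i, g (x i) = i) : (atomicMeasure x).map g = uniformLabel N := by
  have hx : Measurable x := measurable_of_finite x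
  rw [← uniformLabel_map x, Measure.map_map hg hx, show g ∘ x = id from funext hgx, Measure.map_id]

theorem exists_measurable_leftInverse {N : ℕ} (hN : 0 < N) {x : Fin N → ℝ}
    (hx : Function.Injective x) : ∃ g : ℝ → Fin N, Measurable g ∧ ∀ i, g (x i) = i := by
  have : MeasurableEmbedding x := (measurable_of_finite x).measurableEmbedding hx
  obtain ⟨g, hg, hgx⟩ := this.exists_measurable_extend (g := id) measurable_id fun _ => ⟨⟨0, hN⟩⟩
  exact ⟨g, hg, fun i => congrFun hgx i⟩

theorem atomicMeasure_ae_mem_range {N : ℕ} (x : Fin N → ℝ) :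
    ∀ᵐ z ∂(atomicMeasure x), z ∈ Set.range x := by
  have hx : Measurable x := measurable_of_finite x
  rw [← uniformLabel_map x]
  refine (ae_map_iff hx.aemeasurable (Set.finite_range x).measurableSet).2 ?_
  exact .of_forall fun i => ⟨i, rfl⟩

end Labels

/-! ### Intermediate values of atomless measures -/

section Atomless

variable {σ : Measure ℝ} [IsFiniteMeasure σ] [NullSingletonClass σ]

/-- An atomless finite measure on the line takes all intermediate values on subsets. -/
theorem exists_subset_measureReal_eq {A : Set ℝ} (hA : MeasurableSet A)
    (hb : Bornology.IsBounded A) {m : ℝ} (h0 : 0 ≤ m) (hm : m ≤ σ.real A) :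
    ∃ B ⊆ A, MeasurableSet B ∧ σ.real B = m := by
  obtain ⟨r, hr⟩ := hb.subset_closedBall 0
  -- The left end is lowered by `1` because `Ioc` omits it.
  have hIcc : A ⊆ Set.Ioc (-|r| - 1) |r| := fun y hy => by
    have := hr hy
    rw [mem_closedBall_zero_iff, Real.norm_eq_abs] at this
    have h2 := abs_le.1 (this.trans (le_abs_self r))
    exact ⟨by linarith [h2.1], h2.2⟩
  set a := -|r| - 1
  have hab : a ≤ |r| := by have := abs_nonneg r; simp only [a]; linarith
  have hval : ∀ s, a ≤ s → ∫ _ in a..s, (1 : ℝ) ∂(σ.restrict A) = σ.real (A ∩ Set.Ioc a s) := by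
    intro s hs
    rw [intervalIntegral.integral_of_le hs, setIntegral_const, smul_eq_mul, mul_one,
      measureReal_restrict_apply measurableSet_Ioc, Set.inter_comm]
  have hcont : ContinuousOn (fun s => ∫ _ in a..s, (1 : ℝ) ∂(σ.restrict A)) (Set.Icc a |r|) :=
    (intervalIntegral.continuous_primitive
      (fun _ _ => intervalIntegrable_const) a).continuousOn
  obtain ⟨s, hs, hsm⟩ := intermediate_value_Icc hab hcont (show m ∈ _ by
    refine ⟨by simpa using h0, ?_⟩
    rw [hval _ hab, Set.inter_eq_left.2 hIcc]; exact hm)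
  exact ⟨A ∩ Set.Ioc a s, Set.inter_subset_left, hA.inter measurableSet_Ioc, by
    rw [← hval s hs.1]; exact hsm⟩

end Atomless

/-! ### Interval hulls of cells up to null sets -/

section Hull

/-- The points that have a positive amount of the mass of `L` on either side. -/
def essHull (σ : Measure ℝ) (L : Set ℝ) : Set ℝ :=
  {y | σ (L ∩ Set.Iic y) ≠ 0 ∧ σ (L ∩ Set.Ici y) ≠ 0}

theorem essHull_ordConnected (σ : Measure ℝ) (L : Set ℝ) : (essHull σ L).OrdConnected := by
  refine ⟨fun a ha b hb y hy => ⟨fun h => ha.1 ?_, fun h => hb.2 ?_⟩⟩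
  · exact measure_mono_null (Set.inter_subset_inter_right _ (Set.Iic_subset_Iic.2 hy.1)) h
  · exact measure_mono_null (Set.inter_subset_inter_right _ (Set.Ici_subset_Ici.2 hy.2)) h

theorem essHull_subset {σ : Measure ℝ} {L Ω : Set ℝ} (hΩ : Ω.OrdConnected) (hL : L ⊆ Ω) :
    essHull σ L ⊆ Ω := by
  intro y hy
  obtain ⟨a, haL, hay⟩ := nonempty_of_measure_ne_zero hy.1
  obtain ⟨b, hbL, hby⟩ := nonempty_of_measure_ne_zero hy.2
  exact hΩ.out (hL haL) (hL hbL) ⟨hay, hby⟩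

/-- The exceptional set is a down-set. Its rational points give countably many null pieces of `L`,
and these miss at most its greatest element, which is null since `σ` has no atoms. -/
theorem measure_inter_setOf_Iic_null (σ : Measure ℝ) [NullSingletonClass σ] (L : Set ℝ) :
    σ (L ∩ {y | σ (L ∩ Set.Iic y) = 0}) = 0 := by
  set Z := {y | σ (L ∩ Set.Iic y) = 0} with hZ
  have hZ' : L ∩ Z ⊆ (⋃ q ∈ {q : ℚ | (q : ℝ) ∈ Z}, L ∩ Set.Iic (q : ℝ)) ∪
      (Z \ ⋃ q ∈ {q : ℚ | (q : ℝ) ∈ Z}, Set.Iic (q : ℝ)) := by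
    intro y hy
    by_cases h : y ∈ ⋃ q ∈ {q : ℚ | (q : ℝ) ∈ Z}, Set.Iic (q : ℝ)
    · left
      simp only [Set.mem_iUnion] at h ⊢
      obtain ⟨q, hq, hyq⟩ := h
      exact ⟨q, hq, hy.1, hyq⟩
    · exact .inr ⟨hy.2, h⟩
  refine measure_mono_null hZ' (measure_union_null ?_ ?_)
  · exact (measure_biUnion_null_iff (Set.to_countable _)).2 fun q hq => hq
  · refine Set.Subsingleton.measure_zero ?_ σ
    have key : ∀ a ∈ Z \ ⋃ q ∈ {q : ℚ | (q : ℝ) ∈ Z}, Set.Iic (q : ℝ), ∀ b ∈ Z, ¬ a < b := by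
      intro a ha b hb hab
      obtain ⟨q, haq, hqb⟩ := exists_rat_btwn hab
      refine ha.2 (Set.mem_biUnion (x := q) ?_ haq.le)
      exact measure_mono_null (Set.inter_subset_inter_right _ (Set.Iic_subset_Iic.2 hqb.le)) hb
    intro a ha b hb
    exact le_antisymm (not_lt.1 (key b hb a ha.1)) (not_lt.1 (key a ha b hb.1))

theorem measure_inter_setOf_Ici_null (σ : Measure ℝ) [NullSingletonClass σ] (L : Set ℝ) :
    σ (L ∩ {y | σ (L ∩ Set.Ici y) = 0}) = 0 := by
  set Z := {y | σ (L ∩ Set.Ici y) = 0} with hZ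
  have hZ' : L ∩ Z ⊆ (⋃ q ∈ {q : ℚ | (q : ℝ) ∈ Z}, L ∩ Set.Ici (q : ℝ)) ∪
      (Z \ ⋃ q ∈ {q : ℚ | (q : ℝ) ∈ Z}, Set.Ici (q : ℝ)) := by
    intro y hy
    by_cases h : y ∈ ⋃ q ∈ {q : ℚ | (q : ℝ) ∈ Z}, Set.Ici (q : ℝ)
    · left
      simp only [Set.mem_iUnion] at h ⊢
      obtain ⟨q, hq, hyq⟩ := h
      exact ⟨q, hq, hy.1, hyq⟩
    · exact .inr ⟨hy.2, h⟩
  refine measure_mono_null hZ' (measure_union_null ?_ ?_)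
  · exact (measure_biUnion_null_iff (Set.to_countable _)).2 fun q hq => hq
  · refine Set.Subsingleton.measure_zero ?_ σ
    have key : ∀ a ∈ Z \ ⋃ q ∈ {q : ℚ | (q : ℝ) ∈ Z}, Set.Ici (q : ℝ), ∀ b ∈ Z, ¬ b < a := by
      intro a ha b hb hab
      obtain ⟨q, haq, hqb⟩ := exists_rat_btwn hab
      refine ha.2 (Set.mem_biUnion (x := q) ?_ hqb.le)
      exact measure_mono_null (Set.inter_subset_inter_right _ (Set.Ici_subset_Ici.2 haq.le)) hb
    intro a ha b hb
    exact le_antisymm (not_lt.1 (key a ha b hb.1)) (not_lt.1 (key b hb a ha.1))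

theorem ae_mem_essHull (σ : Measure ℝ) [NullSingletonClass σ] (L : Set ℝ) :
    ∀ᵐ y ∂σ, y ∈ L → y ∈ essHull σ L := by
  have h1 := measure_eq_zero_iff_ae_notMem.1 (measure_inter_setOf_Iic_null σ L)
  have h2 := measure_eq_zero_iff_ae_notMem.1 (measure_inter_setOf_Ici_null σ L)
  filter_upwards [h1, h2] with y h1 h2 hy
  exact ⟨fun h => h1 ⟨hy, h⟩, fun h => h2 ⟨hy, h⟩⟩

end Hull

/-! ### Monotonicity of optimal labellings -/

section Swap

variable {N : ℕ} {σ : Measure ℝ} [IsFiniteMeasure σ]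

/-- There are finitely many labels, and each `F · i` is bounded on the compact closure of `Ω`. -/
theorem integrable_comp_label {Ω : Set ℝ} (hΩ : Bornology.IsBounded Ω) (hσ : ∀ᵐ y ∂σ, y ∈ Ω)
    {S : ℝ → ℝ} (hS : Measurable S) (hSΩ : Set.MapsTo S Ω Ω)
    {ι : ℝ → Fin N} (hι : Measurable ι) (F : ℝ → Fin N → ℝ) (hF : ∀ i, Continuous (F · i)) :
    Integrable (fun y => F (S y) (ι y)) σ := by
  have hmeas : Measurable fun y => F (S y) (ι y) := by
    have : Measurable fun p : ℝ × Fin N => F p.1 p.2 :=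
      measurable_from_prod_countable_left fun i => (hF i).measurable
    exact this.comp (hS.prodMk hι)
  have hb : ∀ i, ∃ C, ∀ z ∈ Ω, |F z i| ≤ C := fun i => by
    obtain ⟨C, hC⟩ := hΩ.isCompact_closure.exists_bound_of_continuousOn (hF i).continuousOn
    exact ⟨C, fun z hz => hC z (subset_closure hz)⟩
  choose C hC using hb
  refine Integrable.of_bound hmeas.aestronglyMeasurable (∑ i, |C i|) ?_
  filter_upwards [hσ] with y hy
  refine ((hC (ι y) _ (hSΩ hy)).trans (le_abs_self _)).trans ?_
  exact Finset.single_le_sum (f := fun i => |C i|) (fun i _ => abs_nonneg _) (Finset.mem_univ _)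

/-- In an optimal labelling, the cell with the smaller label lies to the left. -/
theorem measure_inter_Ici_eq_zero_or [NullSingletonClass σ] {Ω : Set ℝ} (hΩ : Bornology.IsBounded Ω)
    (hσ : ∀ᵐ y ∂σ, y ∈ Ω) (x : Fin N → ℝ) {ι : ℝ → Fin N} (hι : Measurable ι)
    (hopt : ∀ κ : ℝ → Fin N, Measurable κ → σ.map κ = σ.map ι →
      ∫ y, (y - x (ι y)) ^ 2 ∂σ ≤ ∫ y, (y - x (κ y)) ^ 2 ∂σ)
    {i j : Fin N} (hij : x i < x j) {A B : Set ℝ} (hA : MeasurableSet A) (hB : MeasurableSet B)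
    (hAΩ : A ⊆ Ω) (hBΩ : B ⊆ Ω) (hAi : ∀ y ∈ A, ι y = i) (hBj : ∀ y ∈ B, ι y = j) (c : ℝ) :
    σ (A ∩ Set.Ici c) = 0 ∨ σ (B ∩ Set.Iic c) = 0 := by
  classical
  by_contra! hcon
  set A₀ := A ∩ Set.Ici c
  set B₀ := B ∩ Set.Iic c
  have hne : i ≠ j := fun h => hij.ne (by rw [h])
  have hpos : 0 < min (σ.real A₀) (σ.real B₀) :=
    lt_min (ENNReal.toReal_pos hcon.1 (measure_ne_top _ _))
      (ENNReal.toReal_pos hcon.2 (measure_ne_top _ _))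
  obtain ⟨A', hA'A, hA', hmA⟩ := exists_subset_measureReal_eq (σ := σ)
    (hA.inter measurableSet_Ici) (hΩ.subset (Set.inter_subset_left.trans hAΩ)) hpos.le
    (min_le_left _ _)
  obtain ⟨B', hB'B, hB', hmB⟩ := exists_subset_measureReal_eq (σ := σ)
    (hB.inter measurableSet_Iic) (hΩ.subset (Set.inter_subset_left.trans hBΩ)) hpos.le
    (min_le_right _ _)
  have hιA : ∀ y ∈ A', ι y = i := fun y hy => hAi y (hA'A hy).1
  have hιB : ∀ y ∈ B', ι y = j := fun y hy => hBj y (hB'B hy).1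
  have hdisj : Disjoint A' B' := Set.disjoint_left.2 fun y h1 h2 =>
    hne ((hιA y h1).symm.trans (hιB y h2))
  have hmeq : σ A' = σ B' := by
    have := hmA.trans hmB.symm
    rwa [measureReal_def, measureReal_def, ENNReal.toReal_eq_toReal_iff' (measure_ne_top _ _)
      (measure_ne_top _ _)] at this
  -- The competitor exchanges the labels of two sets of equal mass, so its law is that of `ι`.
  let κ : ℝ → Fin N := fun y => if y ∈ A' then j else if y ∈ B' then i else ι y
  have hκ : Measurable κ := Measurable.ite hA' measurable_const
    (Measurable.ite hB' measurable_const hι)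
  have hlaw : σ.map κ = σ.map ι := by
    refine Measure.ext_of_singleton fun k => ?_
    have hk : MeasurableSet ({k} : Set (Fin N)) := MeasurableSet.singleton k
    rw [Measure.map_apply hκ hk, Measure.map_apply hι hk]
    have hC : MeasurableSet (A' ∪ B') := hA'.union hB'
    rw [← measure_inter_add_sdiff (κ ⁻¹' {k}) hC, ← measure_inter_add_sdiff (ι ⁻¹' {k}) hC]
    have h1 : κ ⁻¹' {k} \ (A' ∪ B') = ι ⁻¹' {k} \ (A' ∪ B') := by
      ext y
      simp only [Set.mem_sdiff, Set.mem_preimage, Set.mem_union, not_or, Set.mem_singleton_iff]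
      refine and_congr_left fun h => ?_
      simp [κ, h.1, h.2]
    rw [h1]
    congr 1
    have hBA : ∀ y ∈ B', y ∉ A' := fun y h2 h1 => Set.disjoint_left.1 hdisj h1 h2
    by_cases hki : k = i
    · have e1 : κ ⁻¹' {k} ∩ (A' ∪ B') = B' := by
        ext y; simp only [Set.mem_inter_iff, Set.mem_preimage, Set.mem_union,
          Set.mem_singleton_iff, κ, hki]
        grind
      have e2 : ι ⁻¹' {k} ∩ (A' ∪ B') = A' := by
        ext y; simp only [Set.mem_inter_iff, Set.mem_preimage, Set.mem_union,
          Set.mem_singleton_iff, hki]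
        grind
      rw [e1, e2, hmeq]
    · by_cases hkj : k = j
      · have e1 : κ ⁻¹' {k} ∩ (A' ∪ B') = A' := by
          ext y; simp only [Set.mem_inter_iff, Set.mem_preimage, Set.mem_union,
            Set.mem_singleton_iff, κ, hkj]
          grind
        have e2 : ι ⁻¹' {k} ∩ (A' ∪ B') = B' := by
          ext y; simp only [Set.mem_inter_iff, Set.mem_preimage, Set.mem_union,
            Set.mem_singleton_iff, hkj]
          grind
        rw [e1, e2, hmeq]
      · have e1 : κ ⁻¹' {k} ∩ (A' ∪ B') = ∅ := by
          ext y; simp only [Set.mem_inter_iff, Set.mem_preimage, Set.mem_union,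
            Set.mem_singleton_iff, κ, Set.mem_empty_iff_false]
          grind
        have e2 : ι ⁻¹' {k} ∩ (A' ∪ B') = ∅ := by
          ext y; simp only [Set.mem_inter_iff, Set.mem_preimage, Set.mem_union,
            Set.mem_singleton_iff, Set.mem_empty_iff_false]
          grind
        rw [e1, e2]
  have hid : Set.MapsTo (fun y : ℝ => y) Ω Ω := fun _ h => h
  have hint : ∀ {ι' : ℝ → Fin N}, Measurable ι' → ∀ F : ℝ → Fin N → ℝ,
      (∀ i, Continuous (F · i)) → Integrable (fun y => F y (ι' y)) σ := fun h' F hF =>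
    integrable_comp_label hΩ hσ measurable_id' hid h' F hF
  have hsame : ∀ f : Fin N → ℝ, ∫ y, f (κ y) ∂σ = ∫ y, f (ι y) ∂σ := fun f => by
    have hf : Measurable f := measurable_of_finite f
    rw [← integral_map hκ.aemeasurable hf.aestronglyMeasurable, hlaw,
      integral_map hι.aemeasurable hf.aestronglyMeasurable]
  -- Among these terms only `∫ (y - c) * x (ι' y)` can distinguish two labellings with the same law.
  -- Centring at `c` gives the swap a pointwise sign: `A'` lies to the right of `c` and `B'` to the
  -- left.
  have hexp : ∀ {ι' : ℝ → Fin N}, Measurable ι' → ∫ y, (y - x (ι' y)) ^ 2 ∂σ =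
      ∫ y, (y - c) ^ 2 ∂σ - 2 * ∫ y, (y - c) * x (ι' y) ∂σ + ∫ y, (x (ι' y) - c) ^ 2 ∂σ
        + (2 * c * ∫ y, (y - c) ∂σ) := by
    intro ι' h'
    have i1 := hint h' (fun y _ => (y - c) ^ 2) (fun _ => by fun_prop)
    have i2 := hint h' (fun y k => (y - c) * x k) (fun _ => by fun_prop)
    have i3 := hint h' (fun y k => (x k - c) ^ 2) (fun _ => by fun_prop)
    have i4 := hint h' (fun y _ => y - c) (fun _ => by fun_prop)
    have i12 := hint h' (fun y k => (y - c) ^ 2 - 2 * ((y - c) * x k)) (fun _ => by fun_prop)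
    have i123 := hint h' (fun y k => (y - c) ^ 2 - 2 * ((y - c) * x k) + (x k - c) ^ 2)
      (fun _ => by fun_prop)
    rw [← integral_const_mul, ← integral_const_mul, ← integral_sub i1 (i2.const_mul _),
      ← integral_add i12 i3, ← integral_add i123 (i4.const_mul _)]
    refine integral_congr_ae (.of_forall fun y => ?_)
    ring
  have hle := hopt κ hκ hlaw
  rw [hexp hι, hexp hκ, hsame fun k => (x k - c) ^ 2] at hle
  have iκ := hint hκ (fun y k => (y - c) * x k) (fun _ => by fun_prop)
  have iι := hint hι (fun y k => (y - c) * x k) (fun _ => by fun_prop)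
  have hnonneg : ∀ y, 0 ≤ (y - c) * x (κ y) - (y - c) * x (ι y) := by
    intro y
    rw [← mul_sub]
    by_cases h1 : y ∈ A'
    · have : c ≤ y := (hA'A h1).2
      simp only [κ, h1, if_true, hιA y h1]
      exact mul_nonneg (by linarith) (by linarith)
    · by_cases h2 : y ∈ B'
      · have : y ≤ c := (hB'B h2).2
        simp only [κ, h1, h2, if_true, if_false, hιB y h2]
        exact mul_nonneg_of_nonpos_of_nonpos (by linarith) (by linarith)
      · simp [κ, h1, h2]
  have hzero : ∫ y, ((y - c) * x (κ y) - (y - c) * x (ι y)) ∂σ = 0 :=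
    le_antisymm (by rw [integral_sub iκ iι]; linarith) (integral_nonneg hnonneg)
  rw [integral_eq_zero_iff_of_nonneg hnonneg (iκ.sub iι)] at hzero
  -- The gain is strict on `A'` except at `c`, which is not an atom.
  have hcne : ∀ᵐ y ∂σ, y ≠ c := by
    rw [ae_iff]; simp
  have : σ A' = 0 := by
    rw [measure_eq_zero_iff_ae_notMem]
    filter_upwards [hzero, hcne] with y hy hyc hyA
    have h1 : 0 < (y - c) * (x j - x i) :=
      mul_pos (sub_pos.2 (lt_of_le_of_ne (hA'A hyA).2 hyc.symm)) (by linarith)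
    simp only [κ, hyA, if_true, hιA y hyA, Pi.zero_apply] at hy
    linarith [mul_sub (y - c) (x j) (x i)]
  rw [measureReal_def, this] at hmA
  simp at hmA
  linarith

end Swap

/-! ### The half contraction and its effect on entropy -/

section Contraction

open scoped Classical in
/-- The map that contracts `H` by the factor `1/2` towards `b` and fixes the other points. -/
noncomputable def halfContraction (H : Set ℝ) (b y : ℝ) : ℝ :=
  if y ∈ H then (y + b) / 2 else y

/-- The barycenter is only known to lie in the closure of `H`; the midpoint stays in `H` because it
lies between `y` and points of `H` near `b`. -/
theorem midpoint_mem_of_mem_closure {H : Set ℝ} (hH : H.OrdConnected) {b y : ℝ}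
    (hb : b ∈ closure H) (hy : y ∈ H) : (y + b) / 2 ∈ H := by
  rcases lt_trichotomy y b with h | h | h
  · obtain ⟨z, hz, hzH⟩ := mem_closure_iff.1 hb (Set.Ioi ((y + b) / 2)) isOpen_Ioi
      (by simp only [Set.mem_Ioi]; linarith)
    exact hH.out hy hzH ⟨by linarith, le_of_lt hz⟩
  · subst h; simpa using hy
  · obtain ⟨z, hz, hzH⟩ := mem_closure_iff.1 hb (Set.Iio ((y + b) / 2)) isOpen_Iio
      (by simp only [Set.mem_Iio]; linarith)
    exact hH.out hzH hy ⟨le_of_lt hz, by linarith⟩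

variable {H : Set ℝ} {b : ℝ}

theorem halfContraction_of_mem {y : ℝ} (hy : y ∈ H) : halfContraction H b y = (y + b) / 2 :=
  if_pos hy

theorem halfContraction_of_notMem {y : ℝ} (hy : y ∉ H) : halfContraction H b y = y :=
  if_neg hy

theorem measurable_halfContraction (hH : H.OrdConnected) : Measurable (halfContraction H b) := by
  classical
  exact Measurable.ite hH.measurableSet (by fun_prop) measurable_id'

theorem halfContraction_mem_iff (hH : H.OrdConnected) (hb : b ∈ closure H) {y : ℝ} :
    halfContraction H b y ∈ H ↔ y ∈ H := by
  by_cases hy : y ∈ H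
  · simp [halfContraction_of_mem hy, hy, midpoint_mem_of_mem_closure hH hb hy]
  · simp [halfContraction_of_notMem hy]

theorem halfContraction_injective (hH : H.OrdConnected) (hb : b ∈ closure H) :
    Function.Injective (halfContraction H b) := by
  intro y z h
  have hmem : y ∈ H ↔ z ∈ H := by
    rw [← halfContraction_mem_iff hH hb, h, halfContraction_mem_iff hH hb]
  by_cases hy : y ∈ H
  · rw [halfContraction_of_mem hy, halfContraction_of_mem (hmem.1 hy)] at h
    linarith
  · rwa [halfContraction_of_notMem hy, halfContraction_of_notMem (mt hmem.2 hy)] at h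

theorem measurableEmbedding_halfContraction (hH : H.OrdConnected) (hb : b ∈ closure H) :
    MeasurableEmbedding (halfContraction H b) :=
  (measurable_halfContraction hH).measurableEmbedding (halfContraction_injective hH hb)

theorem map_midpoint_volume (b : ℝ) :
    (volume : Measure ℝ).map (fun y => (y + b) / 2) = (2 : ℝ≥0∞) • volume := by
  have h : (fun y : ℝ => (y + b) / 2) = (fun y => 2⁻¹ * y) ∘ fun y => y + b := by
    ext y; simp only [Function.comp_apply]; ring
  rw [h, ← Measure.map_map (by fun_prop) (by fun_prop), map_add_right_eq_self,
    Real.map_volume_mul_left (by norm_num)]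
  norm_num

/-- The density of the image of Lebesgue measure under `halfContraction`. -/
noncomputable def halfContractionDensity (H : Set ℝ) (b : ℝ) : ℝ → ℝ≥0∞ :=
  (halfContraction H b '' H).indicator (fun _ => 2) + Hᶜ.indicator 1

theorem measurableSet_image_halfContraction (hH : H.OrdConnected) (hb : b ∈ closure H) :
    MeasurableSet (halfContraction H b '' H) :=
  (measurableEmbedding_halfContraction hH hb).measurableSet_image.2 hH.measurableSet

theorem measurable_halfContractionDensity (hH : H.OrdConnected) (hb : b ∈ closure H) :
    Measurable (halfContractionDensity H b) :=
  (measurable_const.indicator (measurableSet_image_halfContraction hH hb)).add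
    (measurable_one.indicator hH.measurableSet.compl)

/-- Halving doubles Lebesgue measure on the image of `H`, the complement of `H` is fixed, and what
the contraction vacates in `H` receives density `0`. -/
theorem map_halfContraction_restrict {Ω : Set ℝ} (hH : H.OrdConnected)
    (hHΩ : H ⊆ Ω) (hb : b ∈ closure H) :
    (volume.restrict Ω).map (halfContraction H b) =
      (volume.restrict Ω).withDensity (halfContractionDensity H b) := by
  have hS := measurable_halfContraction (b := b) hH
  have hHm := hH.measurableSet
  have hI := measurableSet_image_halfContraction hH hb
  ext s hs
  rw [Measure.map_apply hS hs, Measure.restrict_apply (hS hs), withDensity_apply _ hs,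
    ← measure_inter_add_sdiff _ hHm]
  have hIH : halfContraction H b '' H ⊆ H := by
    rintro _ ⟨y, hy, rfl⟩
    exact (halfContraction_mem_iff hH hb).2 hy
  have e1 : halfContraction H b ⁻¹' s ∩ Ω ∩ H =
      (fun y => (y + b) / 2) ⁻¹' (s ∩ halfContraction H b '' H) := by
    ext y
    simp only [Set.mem_inter_iff, Set.mem_preimage, Set.mem_image]
    constructor
    · rintro ⟨⟨h1, -⟩, h3⟩
      rw [halfContraction_of_mem h3] at h1
      exact ⟨h1, y, h3, halfContraction_of_mem h3⟩
    · rintro ⟨h1, z, hz, hzy⟩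
      rw [halfContraction_of_mem hz] at hzy
      obtain rfl : z = y := by linarith
      exact ⟨⟨by rwa [halfContraction_of_mem hz], hHΩ hz⟩, hz⟩
  have e2 : (halfContraction H b ⁻¹' s ∩ Ω) \ H = s ∩ Ω ∩ Hᶜ := by
    ext y
    simp only [Set.mem_sdiff, Set.mem_inter_iff, Set.mem_preimage, Set.mem_compl_iff]
    refine and_congr_left fun h => ?_
    rw [halfContraction_of_notMem h]
  rw [e1, e2, ← Measure.map_apply (by fun_prop) (hs.inter hI), map_midpoint_volume,
    halfContractionDensity]
  simp only [Pi.add_apply]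
  rw [lintegral_add_left (measurable_const.indicator hI), lintegral_indicator hI,
    lintegral_indicator hHm.compl]
  simp only [lintegral_const, Pi.one_apply, one_mul, Measure.restrict_restrict hI,
    Measure.restrict_restrict hHm.compl, Measure.restrict_restrict hs,
    Measure.restrict_apply_univ, Measure.smul_apply, smul_eq_mul]
  congr 2
  · congr 1
    ext y
    simp only [Set.mem_inter_iff]
    have : y ∈ halfContraction H b '' H → y ∈ Ω := fun h => hHΩ (hIH h)
    tauto
  · ext y
    simp only [Set.mem_inter_iff]
    tauto

/-- Along the contraction the density takes only the values `2` and `1`, so its logarithm never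
meets the vacated region. -/
theorem halfContractionDensity_apply (hH : H.OrdConnected) (hb : b ∈ closure H) (y : ℝ) :
    Real.log (halfContractionDensity H b (halfContraction H b y)).toReal =
      H.indicator (fun _ => Real.log 2) y ∧
    halfContractionDensity H b (halfContraction H b y) ≠ 0 ∧
    halfContractionDensity H b (halfContraction H b y) ≠ ∞ := by
  have hinj := halfContraction_injective hH hb
  by_cases hy : y ∈ H
  · have h1 : halfContraction H b y ∈ H := (halfContraction_mem_iff hH hb).2 hy
    have : halfContractionDensity H b (halfContraction H b y) = 2 := by
      simp [halfContractionDensity, h1, hinj.mem_set_image, hy]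
    simp [this, hy]
  · have h1 : halfContraction H b y ∉ H := mt (halfContraction_mem_iff hH hb).1 hy
    have : halfContractionDensity H b (halfContraction H b y) = 1 := by
      simp [halfContractionDensity, h1, hinj.mem_set_image, hy]
    simp [this, hy]

variable {Ω : Set ℝ} {σ : Measure ℝ} [IsFiniteMeasure σ]

/-- Chain rule through `lam.map S`: by injectivity the first factor, read at `S y`, is the density
of `σ` at `y`, and the second is `halfContractionDensity`. The logarithm turns the product into a
sum. -/
theorem log_rnDeriv_map_halfContraction (hΩf : volume Ω ≠ ∞)
    (hH : H.OrdConnected) (hHΩ : H ⊆ Ω) (hb : b ∈ closure H)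
    (hσ : σ ≪ volume.restrict Ω) :
    σ.map (halfContraction H b) ≪ volume.restrict Ω ∧
    ∀ᵐ y ∂σ, Real.log ((σ.map (halfContraction H b)).rnDeriv (volume.restrict Ω)
        (halfContraction H b y)).toReal =
      Real.log (σ.rnDeriv (volume.restrict Ω) y).toReal + H.indicator (fun _ => Real.log 2) y := by
  set lam : Measure ℝ := volume.restrict Ω with hlam
  have : IsFiniteMeasure lam := ⟨by simpa [hlam] using hΩf.lt_top⟩
  set S := halfContraction H b
  have hS : MeasurableEmbedding S := measurableEmbedding_halfContraction hH hb
  have hmap : lam.map S = lam.withDensity (halfContractionDensity H b) :=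
    map_halfContraction_restrict hH hHΩ hb
  have hmapac : lam.map S ≪ lam := hmap ▸ withDensity_absolutelyContinuous _ _
  have hac : σ.map S ≪ lam.map S := hσ.map hS.measurable
  refine ⟨hac.trans hmapac, ?_⟩
  have h1 := hS.rnDeriv_map σ lam
  have h2 : (σ.map S).rnDeriv (lam.map S) * (lam.map S).rnDeriv lam =ᵐ[lam]
    (σ.map S).rnDeriv lam := Measure.rnDeriv_mul_rnDeriv hac
  have h3 : (lam.map S).rnDeriv lam =ᵐ[lam] halfContractionDensity H b := by
    rw [hmap]
    exact Measure.rnDeriv_withDensity _ (measurable_halfContractionDensity hH hb)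
  have h2' := ae_of_ae_map hS.measurable.aemeasurable (hmapac h2)
  have h3' := ae_of_ae_map hS.measurable.aemeasurable (hmapac h3)
  filter_upwards [hσ h1, hσ h2', hσ h3', Measure.rnDeriv_pos hσ, hσ (Measure.rnDeriv_lt_top σ lam)]
    with y h1 h2 h3 h4 h5
  obtain ⟨k1, k2, k3⟩ := halfContractionDensity_apply hH hb y
  rw [← h2, Pi.mul_apply, h1, h3, ENNReal.toReal_mul, Real.log_mul, k1]
  · exact (ENNReal.toReal_pos h4.ne' h5.ne).ne'
  · exact (ENNReal.toReal_pos k2 k3).ne'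

/-- The halving of a set that carries the mass `m` increases the entropy by `m log 2`. -/
theorem Ent_map_halfContraction (hΩf : volume Ω ≠ ∞)
    (hH : H.OrdConnected) (hHΩ : H ⊆ Ω) (hb : b ∈ closure H) (hσ : σ ≪ volume.restrict Ω)
    (hint : Integrable (fun y => Real.log (σ.rnDeriv (volume.restrict Ω) y).toReal) σ) :
    Ent Ω (σ.map (halfContraction H b)) =
      ((∫ y, Real.log (σ.rnDeriv (volume.restrict Ω) y).toReal ∂σ + σ.real H * Real.log 2 : ℝ)
        : EReal) := by
  obtain ⟨hac, hae⟩ := log_rnDeriv_map_halfContraction hΩf hH hHΩ hb hσ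
  have hS := measurableEmbedding_halfContraction hH hb
  have hind : Integrable (H.indicator fun _ => Real.log 2) σ :=
    (integrable_const _).indicator hH.measurableSet
  have hint' := (hint.add hind).congr (hae.mono fun y hy => hy.symm)
  rw [Ent, if_pos ⟨hac, hS.integrable_map_iff.2 hint'⟩, hS.integral_map,
    integral_congr_ae hae, integral_add hint hind, integral_indicator hH.measurableSet,
    setIntegral_const, smul_eq_mul]

end Contraction

/-! ### Competitors of finite entropy -/

section UniformMeasure

/-- The uniform probability measure on `Ω` has finite entropy. -/
theorem exists_mem_probOn_Ent_ne_top {Ω : Set ℝ} (hΩ : MeasurableSet Ω) (h0 : volume Ω ≠ 0)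
    (hf : volume Ω ≠ ∞) : ∃ ρ ∈ probOn Ω, Ent Ω ρ ≠ ⊤ := by
  set lam : Measure ℝ := volume.restrict Ω with hlam
  have : IsFiniteMeasure lam := ⟨by simpa [hlam] using hf.lt_top⟩
  have hc : (volume Ω)⁻¹ ≠ ∞ := ENNReal.inv_ne_top.2 h0
  refine ⟨(volume Ω)⁻¹ • lam, ⟨⟨?_⟩, ?_⟩, ?_⟩
  · simp [hlam, ENNReal.inv_mul_cancel h0 hf]
  · simp [hlam, hΩ.compl]
  · have hac : (volume Ω)⁻¹ • lam ≪ lam := Measure.smul_absolutelyContinuous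
    have hd : ((volume Ω)⁻¹ • lam).rnDeriv lam =ᵐ[lam] fun _ => (volume Ω)⁻¹ := by
      filter_upwards [Measure.rnDeriv_smul_left_of_ne_top lam lam hc, Measure.rnDeriv_self lam]
        with y h1 h2
      simp [h1, h2]
    have : IsFiniteMeasure ((volume Ω)⁻¹ • lam) := Measure.smul_finite _ hc
    have hi : Integrable (fun y => Real.log (((volume Ω)⁻¹ • lam).rnDeriv lam y).toReal)
        ((volume Ω)⁻¹ • lam) :=
      (integrable_const (Real.log ((volume Ω)⁻¹).toReal)).congr (by
        filter_upwards [hac hd] with y hy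
        rw [hy])
    rw [Ent, if_pos ⟨hac, hi⟩]
    exact EReal.coe_ne_top _

theorem absolutelyContinuous_of_Ent_ne_top {Ω : Set ℝ} {ρ : Measure ℝ} (h : Ent Ω ρ ≠ ⊤) :
    ρ ≪ volume.restrict Ω ∧
      Integrable (fun y => Real.log (ρ.rnDeriv (volume.restrict Ω) y).toReal) ρ := by
  by_contra hc
  exact h (if_neg hc)

end UniformMeasure

/-! ### Laguerre cells and their masses -/

section Cells

variable {N : ℕ} {x : Fin N → ℝ} {σ : Measure ℝ} {T : ℝ → ℝ} {Ω : Set ℝ} {ι : ℝ → Fin N}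

/-- `T` takes values among the `x i` only almost everywhere. The last clause nevertheless holds at
every point, so cells carry their label without exceptional sets. -/
theorem exists_label (hN : 0 < N) (hx : Function.Injective x) (hT : Measurable T)
    (hTσ : σ.map T = atomicMeasure x) :
    ∃ ι : ℝ → Fin N, Measurable ι ∧ σ.map ι = uniformLabel N ∧ (∀ᵐ y ∂σ, T y = x (ι y)) ∧
      ∀ i y, T y = x i → ι y = i := by
  obtain ⟨g, hg, hgx⟩ := exists_measurable_leftInverse hN hx
  refine ⟨g ∘ T, hg.comp hT, ?_, ?_, fun i y h => by simp [h, hgx]⟩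
  · rw [← Measure.map_map hg hT, hTσ, atomicMeasure_map x hg hgx]
  · have := atomicMeasure_ae_mem_range x
    rw [← hTσ] at this
    filter_upwards [ae_of_ae_map hT.aemeasurable this] with y ⟨i, hi⟩
    simp [← hi, hgx]

theorem mem_laguerreCell_iff_ae (hσ : ∀ᵐ y ∂σ, y ∈ Ω) (hTι : ∀ᵐ y ∂σ, T y = x (ι y))
    (hι : ∀ i y, T y = x i → ι y = i) :
    ∀ᵐ y ∂σ, ∀ i, y ∈ laguerreCell Ω T (x i) ↔ ι y = i := by
  filter_upwards [hσ, hTι] with y h1 h2 i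
  exact ⟨fun h => hι i y h.2, fun h => ⟨h1, by rw [h2, h]⟩⟩

theorem measurableSet_laguerreCell (hΩ : MeasurableSet Ω) (hT : Measurable T) (z : ℝ) :
    MeasurableSet (laguerreCell Ω T z) :=
  hΩ.inter (hT (measurableSet_singleton z))

theorem measure_laguerreCell (hιm : Measurable ι) (hmap : σ.map ι = uniformLabel N)
    (hcell : ∀ᵐ y ∂σ, ∀ i, y ∈ laguerreCell Ω T (x i) ↔ ι y = i) (i : Fin N) :
    σ (laguerreCell Ω T (x i)) = (N : ℝ≥0∞)⁻¹ := by
  rw [← uniformLabel_singleton i, ← hmap, Measure.map_apply hιm (MeasurableSet.singleton i)]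
  exact measure_congr (by
    filter_upwards [hcell] with y hy
    exact propext (hy i))

/-- The cost of transporting every cell to a single point. -/
theorem W2sq_atomicMeasure_le [IsFiniteMeasure σ] (hΩ : MeasurableSet Ω)
    (hb : Bornology.IsBounded Ω) (hσ : ∀ᵐ y ∂σ, y ∈ Ω) (hT : Measurable T) (hιm : Measurable ι)
    (hmap : σ.map ι = uniformLabel N)
    (hcell : ∀ᵐ y ∂σ, ∀ i, y ∈ laguerreCell Ω T (x i) ↔ ι y = i) (β : Fin N → ℝ) :
    W2sq σ (atomicMeasure β) ≤
      ENNReal.ofReal (∑ i, ∫ y in laguerreCell Ω T (x i), (y - β i) ^ 2 ∂σ) := by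
  have hβ : Measurable β := measurable_of_finite β
  -- The coupling sends `y` to `β (ι y)`.
  have h := W2sq_map_map_le σ measurable_id (hβ.comp hιm)
  rw [Measure.map_id, ← Measure.map_map hβ hιm, hmap, uniformLabel_map] at h
  have hid : Set.MapsTo (fun y : ℝ => y) Ω Ω := fun _ h => h
  refine h.trans_eq ?_
  simp only [id, Function.comp_apply]
  rw [lintegral_edist_sq_eq_ofReal (integrable_comp_label hb hσ measurable_id' hid hιm
    (fun y i => (y - β i) ^ 2) fun _ => by fun_prop)]
  congr 1
  have hL := fun i => measurableSet_laguerreCell hΩ hT (x i)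
  simp_rw [← integral_indicator (hL _)]
  rw [← integral_finsetSum _ fun i _ => ((integrable_comp_label hb hσ measurable_id' hid hιm
    (fun y _ => (y - β i) ^ 2) fun _ => by fun_prop).indicator (hL i))]
  refine integral_congr_ae ?_
  filter_upwards [hcell] with y hy
  rw [Finset.sum_eq_single (ι y), Set.indicator_of_mem ((hy _).2 rfl)]
  · exact fun i _ hi => Set.indicator_of_notMem (fun h => hi ((hy i).1 h).symm) _
  · exact fun h => absurd (Finset.mem_univ _) h

end Cells

/-! ### Barycenters and variances of cells -/

section Variance

variable {σ : Measure ℝ} [IsFiniteMeasure σ] {L H : Set ℝ}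

theorem cellBarycenter_eq_average (σ : Measure ℝ) (L : Set ℝ) :
    cellBarycenter σ L = ⨍ y in L, y ∂σ := by
  rw [setAverage_eq, cellBarycenter, smul_eq_mul, measureReal_def, div_eq_inv_mul]

theorem integrableOn_of_bounded (hb : Bornology.IsBounded H) (hL : MeasurableSet L)
    (hLH : ∀ᵐ y ∂σ, y ∈ L → y ∈ H) {F : ℝ → ℝ} (hF : Continuous F) : IntegrableOn F L σ := by
  obtain ⟨C, hC⟩ := hb.isCompact_closure.exists_bound_of_continuousOn hF.continuousOn
  refine Integrable.of_bound hF.aestronglyMeasurable C ?_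
  filter_upwards [(ae_restrict_iff' hL).2 hLH] with y hy
  exact hC y (subset_closure hy)

theorem cellBarycenter_mem_closure (hH : H.OrdConnected) (hb : Bornology.IsBounded H)
    (hL : MeasurableSet L) (hLH : ∀ᵐ y ∂σ, y ∈ L → y ∈ H) (h0 : σ L ≠ 0) :
    cellBarycenter σ L ∈ closure H := by
  rw [cellBarycenter_eq_average]
  exact hH.convex.set_average_mem_closure h0 (measure_ne_top _ _) ((ae_restrict_iff' hL).2 hLH)
    (integrableOn_of_bounded hb hL hLH continuous_id)

/-- The open interval between `y` and `b` lies in `H`, even if `b` does not. -/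
theorem abs_sub_le_volume (hH : H.OrdConnected) (hb : Bornology.IsBounded H) {y b : ℝ}
    (hy : y ∈ H) (hbH : b ∈ closure H) : |y - b| ≤ volume.real H := by
  have hf : volume H ≠ ∞ := hb.measure_lt_top.ne
  rcases le_total y b with h | h
  · have hsub : Set.Ioo y b ⊆ H := fun z hz => by
      obtain ⟨w, hw, hwH⟩ := mem_closure_iff.1 hbH (Set.Ioi z) isOpen_Ioi hz.2
      exact hH.out hy hwH ⟨hz.1.le, le_of_lt hw⟩
    have := measureReal_mono hsub hf
    rw [Real.volume_real_Ioo_of_le h] at this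
    rwa [abs_sub_comm, abs_of_nonneg (sub_nonneg.2 h)]
  · have hsub : Set.Ioo b y ⊆ H := fun z hz => by
      obtain ⟨w, hw, hwH⟩ := mem_closure_iff.1 hbH (Set.Iio z) isOpen_Iio hz.1
      exact hH.out hwH hy ⟨le_of_lt hw, hz.2.le⟩
    have := measureReal_mono hsub hf
    rw [Real.volume_real_Ioo_of_le h] at this
    rwa [abs_of_nonneg (sub_nonneg.2 h)]

theorem setIntegral_sub_cellBarycenter_sq_le (hH : H.OrdConnected) (hb : Bornology.IsBounded H)
    (hL : MeasurableSet L) (hLH : ∀ᵐ y ∂σ, y ∈ L → y ∈ H) (h0 : σ L ≠ 0) :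
    ∫ y in L, (y - cellBarycenter σ L) ^ 2 ∂σ ≤ volume.real H ^ 2 * σ.real L := by
  have hβ := cellBarycenter_mem_closure hH hb hL hLH h0
  have h1 : ∫ y in L, (y - cellBarycenter σ L) ^ 2 ∂σ ≤ ∫ _ in L, volume.real H ^ 2 ∂σ := by
    refine setIntegral_mono_on_ae (integrableOn_of_bounded hb hL hLH (by fun_prop))
      (integrable_const _) hL ?_
    filter_upwards [hLH] with y hy hyL
    rw [← sq_abs]
    exact pow_le_pow_left₀ (abs_nonneg _) (abs_sub_le_volume hH hb (hy hyL) hβ) 2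
  rwa [setIntegral_const, smul_eq_mul, mul_comm] at h1

theorem setIntegral_sub_cellBarycenter (hb : Bornology.IsBounded H)
    (hL : MeasurableSet L) (hLH : ∀ᵐ y ∂σ, y ∈ L → y ∈ H) (h0 : σ L ≠ 0) :
    ∫ y in L, (y - cellBarycenter σ L) ∂σ = 0 := by
  have hpos : (σ L).toReal ≠ 0 := (ENNReal.toReal_pos h0 (measure_ne_top _ _)).ne'
  rw [integral_sub (f := fun y => y) (integrableOn_of_bounded hb hL hLH continuous_id)
    (integrable_const _),
    setIntegral_const, smul_eq_mul, cellBarycenter, measureReal_def, mul_div_cancel₀ _ hpos,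
    sub_self]

end Variance

/-! ### Consequences of minimality -/

section Minimizer

variable {N : ℕ} {x : Fin N → ℝ} {σ : Measure ℝ} {T : ℝ → ℝ} {Ω : Set ℝ} {ι : ℝ → Fin N} {ε : ℝ}

theorem ofReal_mul_coe_ereal {c I : ℝ} (hc : 0 ≤ c) (hI : 0 ≤ I) :
    ((ENNReal.ofReal c * ENNReal.ofReal I : ℝ≥0∞) : EReal) = ((c * I : ℝ) : EReal) := by
  rw [← ENNReal.ofReal_mul hc, EReal.coe_ennreal_ofReal, max_eq_left (mul_nonneg hc hI)]

theorem W2sq_eq_ofReal [IsFiniteMeasure σ] (hb : Bornology.IsBounded Ω) (hσ : ∀ᵐ y ∂σ, y ∈ Ω)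
    (hιm : Measurable ι) (hTι : ∀ᵐ y ∂σ, T y = x (ι y))
    (hopt : IsOptimalMap σ (atomicMeasure x) T) :
    W2sq σ (atomicMeasure x) = ENNReal.ofReal (∫ y, (y - x (ι y)) ^ 2 ∂σ) := by
  rw [← hopt.2.2, ← lintegral_edist_sq_eq_ofReal (integrable_comp_label hb hσ measurable_id'
    (fun _ h => h) hιm (fun y i => (y - x i) ^ 2) fun _ => by fun_prop)]
  refine lintegral_congr_ae ?_
  filter_upwards [hTι] with y hy
  rw [hy]

theorem W2sq_map_le_ofReal [IsFiniteMeasure σ] (hb : Bornology.IsBounded Ω)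
    (hσ : ∀ᵐ y ∂σ, y ∈ Ω) (x : Fin N → ℝ) (hιm : Measurable ι) (hmap : σ.map ι = uniformLabel N)
    {S : ℝ → ℝ} (hS : Measurable S) (hSΩ : Set.MapsTo S Ω Ω) :
    W2sq (σ.map S) (atomicMeasure x) ≤ ENNReal.ofReal (∫ y, (S y - x (ι y)) ^ 2 ∂σ) := by
  have hx : Measurable x := measurable_of_finite x
  have h := W2sq_map_map_le σ hS (hx.comp hιm)
  rw [← Measure.map_map hx hιm, hmap, uniformLabel_map] at h
  exact h.trans_eq (lintegral_edist_sq_eq_ofReal (integrable_comp_label hb hσ hS hSΩ hιm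
    (fun y i => (y - x i) ^ 2) fun _ => by fun_prop))

/-- A labelling with the same law induces a plan between `σ` and the atoms, so optimality of `T`
passes to labels. -/
theorem integral_sq_le_of_map_eq [IsFiniteMeasure σ] (hb : Bornology.IsBounded Ω)
    (hσ : ∀ᵐ y ∂σ, y ∈ Ω) (hιm : Measurable ι) (hmap : σ.map ι = uniformLabel N)
    (hTι : ∀ᵐ y ∂σ, T y = x (ι y)) (hopt : IsOptimalMap σ (atomicMeasure x) T)
    {κ : ℝ → Fin N} (hκ : Measurable κ) (hκι : σ.map κ = σ.map ι) :
    ∫ y, (y - x (ι y)) ^ 2 ∂σ ≤ ∫ y, (y - x (κ y)) ^ 2 ∂σ := by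
  have h := W2sq_map_le_ofReal hb hσ x hκ (hκι.trans hmap) measurable_id (fun _ h => h)
  rw [Measure.map_id, W2sq_eq_ofReal hb hσ hιm hTι hopt] at h
  exact (ENNReal.ofReal_le_ofReal_iff (integral_nonneg fun _ => sq_nonneg _)).1 h

/-- The product coupling has bounded cost, as `Ω` is bounded and there are finitely many atoms. -/
theorem W2sq_atomicMeasure_ne_top (hN : 0 < N) (x : Fin N → ℝ) (hb : Bornology.IsBounded Ω)
    {ρ : Measure ℝ} (hρ : ρ ∈ probOn Ω) : W2sq (atomicMeasure x) ρ ≠ ∞ := by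
  have : IsProbabilityMeasure ρ := hρ.1
  have hρΩ : ∀ᵐ y ∂ρ, y ∈ Ω := hρ.2
  have : IsProbabilityMeasure (uniformLabel N) := ⟨by
    have : (N : ℝ≥0∞) ≠ 0 := by simpa using hN.ne'
    simp [uniformLabel, ENNReal.inv_mul_cancel this]⟩
  have hx : Measurable x := measurable_of_finite x
  have h := W2sq_map_map_le ((uniformLabel N).prod ρ) (hx.comp measurable_fst) measurable_snd
  rw [← Measure.map_map hx measurable_fst, Measure.map_fst_prod, Measure.map_snd_prod,
    measure_univ, measure_univ, one_smul, one_smul, uniformLabel_map] at h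
  refine (h.trans_lt ?_).ne
  have hC : ∀ i, ∃ C, ∀ y ∈ Ω, edist (x i) y ^ 2 ≤ ENNReal.ofReal C := fun i => by
    obtain ⟨C, hC⟩ := hb.isCompact_closure.exists_bound_of_continuousOn
      (f := fun y => (x i - y) ^ 2) (by fun_prop)
    refine ⟨C, fun y hy => ?_⟩
    rw [edist_sq_eq_ofReal]
    exact ENNReal.ofReal_le_ofReal ((le_abs_self _).trans (hC y (subset_closure hy)))
  choose C hC using hC
  have hsnd : ∀ᵐ p ∂(uniformLabel N).prod ρ, p.2 ∈ Ω :=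
    Measure.quasiMeasurePreserving_snd.ae hρΩ
  calc ∫⁻ p, edist ((x ∘ Prod.fst) p) p.2 ^ 2 ∂(uniformLabel N).prod ρ
      ≤ ∫⁻ _, ∑ i, ENNReal.ofReal (C i) ∂(uniformLabel N).prod ρ := by
        refine lintegral_mono_ae ?_
        filter_upwards [hsnd] with p hp
        exact (hC p.1 p.2 hp).trans (Finset.single_le_sum
          (f := fun i => ENNReal.ofReal (C i)) (fun _ _ => zero_le) (Finset.mem_univ _))
    _ < ∞ := by simp

theorem IsEntMinimizer.Ent_ne_top (hΩ : MeasurableSet Ω) (hb : Bornology.IsBounded Ω)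
    (h0 : volume Ω ≠ 0) (hN : 0 < N) (hmin : IsEntMinimizer Ω ε (atomicMeasure x) σ) :
    Ent Ω σ ≠ ⊤ := by
  obtain ⟨ρ, hρ, hfin⟩ := exists_mem_probOn_Ent_ne_top hΩ h0 hb.measure_lt_top.ne
  have hW := ENNReal.mul_ne_top (ENNReal.ofReal_ne_top (r := 1 / (2 * ε)))
    (W2sq_atomicMeasure_ne_top hN x hb hρ)
  intro htop
  have hle := hmin.2 ρ hρ
  rw [penalizedEnt, htop, EReal.add_top_of_ne_bot (EReal.coe_ennreal_ne_bot _), top_le_iff] at hle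
  exact EReal.add_ne_top (EReal.coe_ennreal_eq_top_iff.not.2 hW) hfin hle

/-- The competitor is the image of `σ` under the contraction of `H` towards the barycenter. Keeping
the old labels gives an admissible plan, which is enough since only an upper bound on its cost is
needed. -/
theorem setIntegral_sq_le_of_isEntMinimizer (hΩ : Ω.OrdConnected) (hb : Bornology.IsBounded Ω)
    (hε : 0 < ε) (hmin : IsEntMinimizer Ω ε (atomicMeasure x) σ)
    (hopt : IsOptimalMap σ (atomicMeasure x) T) (hfin : Ent Ω σ ≠ ⊤)
    (hιm : Measurable ι) (hmap : σ.map ι = uniformLabel N) (hTι : ∀ᵐ y ∂σ, T y = x (ι y))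
    (i : Fin N) {L H : Set ℝ} (hL : MeasurableSet L) (hLι : ∀ y ∈ L, ι y = i)
    (hH : H.OrdConnected) (hHΩ : H ⊆ Ω) (hHL : ∀ᵐ y ∂σ, y ∈ H ↔ y ∈ L) (h0 : σ L ≠ 0) :
    ∫ y in L, (y - cellBarycenter σ L) ^ 2 ∂σ ≤ 2 * ε * σ.real L := by
  obtain ⟨hac, hlog⟩ := absolutelyContinuous_of_Ent_ne_top hfin
  have hprob : IsProbabilityMeasure σ := hmin.1.1
  have hσ : ∀ᵐ y ∂σ, y ∈ Ω := hmin.1.2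
  have hHb := hb.subset hHΩ
  have hLH : ∀ᵐ y ∂σ, y ∈ L → y ∈ H := hHL.mono fun y h => h.2
  set β := cellBarycenter σ L with hβdef
  have hβ : β ∈ closure H := cellBarycenter_mem_closure hH hHb hL hLH h0
  have hS := measurable_halfContraction (b := β) hH
  have hSΩ : Set.MapsTo (halfContraction H β) Ω Ω := fun y hy => by
    by_cases h : y ∈ H
    · exact hHΩ ((halfContraction_mem_iff hH hβ).2 h)
    · rwa [halfContraction_of_notMem h]
  have hρ : σ.map (halfContraction H β) ∈ probOn Ω := by
    refine ⟨Measure.isProbabilityMeasure_map hS.aemeasurable, ?_⟩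
    rw [Measure.map_apply hS hΩ.measurableSet.compl]
    exact measure_mono_null (fun y hy hyΩ => hy (hSΩ hyΩ)) (ae_iff.1 hσ)
  have hle := hmin.2 _ hρ
  have hc : 0 ≤ 1 / (2 * ε) := by positivity
  have hEσ : Ent Ω σ =
      ((∫ y, Real.log (σ.rnDeriv (volume.restrict Ω) y).toReal ∂σ : ℝ) : EReal) :=
    if_pos ⟨hac, hlog⟩
  have hW' : ((ENNReal.ofReal (1 / (2 * ε)) *
      W2sq (atomicMeasure x) (σ.map (halfContraction H β)) : ℝ≥0∞) : EReal) ≤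
      ((1 / (2 * ε) * ∫ y, (halfContraction H β y - x (ι y)) ^ 2 ∂σ : ℝ) : EReal) := by
    rw [← ofReal_mul_coe_ereal hc (integral_nonneg fun _ => sq_nonneg _),
      EReal.coe_ennreal_le_coe_ennreal_iff, W2sq_comm]
    gcongr
    exact W2sq_map_le_ofReal hb hσ x hιm hmap hS hSΩ
  have hle' := hle.trans (add_le_add_left hW' _)
  rw [penalizedEnt, W2sq_comm, W2sq_eq_ofReal hb hσ hιm hTι hopt,
    ofReal_mul_coe_ereal hc (integral_nonneg fun _ => sq_nonneg _), hEσ,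
    Ent_map_halfContraction hb.measure_lt_top.ne hH hHΩ hβ hac hlog,
    ← EReal.coe_add, ← EReal.coe_add, EReal.coe_le_coe_iff] at hle'
  have hHr : σ.real H = σ.real L := measureReal_congr (hHL.mono fun y h => propext h)
  have i1 := integrable_comp_label hb hσ measurable_id' (fun _ h => h) hιm
    (fun y i => (y - x i) ^ 2) fun _ => by fun_prop
  have i2 := integrable_comp_label hb hσ hS hSΩ hιm
    (fun y i => (y - x i) ^ 2) fun _ => by fun_prop
  have hdiff : ∫ y, (y - x (ι y)) ^ 2 ∂σ - ∫ y, (halfContraction H β y - x (ι y)) ^ 2 ∂σ =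
      3 / 4 * ∫ y in L, (y - β) ^ 2 ∂σ := by
    -- With `u = y - β` and `v = β - x i`, one has `(u + v)² - (u/2 + v)² = 3/4 u² + uv`; the
    -- barycenter kills the integral of `uv`.
    have hz : ∫ y in L, (β - x i) * (y - β) ∂σ = 0 := by
      rw [integral_const_mul, setIntegral_sub_cellBarycenter hHb hL hLH h0, mul_zero]
    rw [← integral_sub i1 i2, ← integral_const_mul, ← add_zero (∫ y in L, _ ∂σ), ← hz,
      ← integral_add (integrableOn_of_bounded hHb hL hLH (by fun_prop))
        (integrableOn_of_bounded hHb hL hLH (by fun_prop)), ← integral_indicator hL]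
    refine integral_congr_ae ?_
    filter_upwards [hHL] with y hy
    by_cases h : y ∈ L
    · rw [halfContraction_of_mem (hy.2 h), Set.indicator_of_mem h, hLι y h]
      ring
    · rw [halfContraction_of_notMem (mt hy.1 h), Set.indicator_of_notMem h, sub_self]
  have hV : 1 / (2 * ε) * (3 / 4 * ∫ y in L, (y - β) ^ 2 ∂σ) ≤ σ.real L * Real.log 2 := by
    rw [← hdiff, ← hHr]
    linarith
  -- Replacing `log 2` by `3/4` cancels the factor `3/4` and leaves the constant `2`.
  have hlog2 : σ.real L * Real.log 2 ≤ σ.real L * (3 / 4) :=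
    mul_le_mul_of_nonneg_left (by linarith [Real.log_two_lt_d9]) measureReal_nonneg
  have h2 := hV.trans hlog2
  rw [one_div, inv_mul_le_iff₀ (by positivity)] at h2
  linarith

end Minimizer

/-! ### Interpolating the two bounds and summing over cells -/

/-- Short cells (`h ≤ √ε`) use the length bound, long ones the entropy bound. The result is linear
in `h`, hence summable over disjoint intervals. -/
theorem le_two_mul_sqrt_mul {V ε h m : ℝ} (hε : 0 ≤ ε) (hh : 0 ≤ h) (hm : 0 ≤ m)
    (h1 : V ≤ 2 * ε * m) (h2 : V ≤ h ^ 2 * m) : V ≤ 2 * √ε * h * m := by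
  have hs := Real.sq_sqrt hε
  have hs0 := Real.sqrt_nonneg ε
  rcases le_total h (√ε) with hle | hle
  · refine h2.trans (mul_le_mul_of_nonneg_right ?_ hm)
    nlinarith
  · refine h1.trans (mul_le_mul_of_nonneg_right ?_ hm)
    nlinarith

theorem proposition4p2 :
    ∃ C : ℝ → ℝ, ∀ (Ω : Set ℝ), Ω.OrdConnected → Bornology.IsBounded Ω →
      ∀ (N : ℕ), 0 < N → ∀ (x : Fin N → ℝ), Function.Injective x →
      ∀ (ε : ℝ), 0 < ε →
      ∀ (σ : Measure ℝ), IsEntMinimizer Ω ε (atomicMeasure x) σ →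
      ∀ (T : ℝ → ℝ), IsOptimalMap σ (atomicMeasure x) T →
        W2sq σ (atomicMeasure fun i => cellBarycenter σ (laguerreCell Ω T (x i)))
          ≤ ENNReal.ofReal (C (volume.real Ω) * (√ε / N)) := by
  refine ⟨fun l => 2 * l, fun Ω hΩ hb N hN x hx ε hε σ hmin T hopt => ?_⟩
  have hprob : IsProbabilityMeasure σ := hmin.1.1
  have hσ : ∀ᵐ y ∂σ, y ∈ Ω := hmin.1.2
  have hΩm := hΩ.measurableSet
  obtain ⟨ι, hιm, hmap, hTι, hι⟩ := exists_label hN hx hopt.1 hopt.2.1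
  have hcell := mem_laguerreCell_iff_ae hσ hTι hι
  set L := fun i => laguerreCell Ω T (x i) with hLdef
  have hL : ∀ i, MeasurableSet (L i) := fun i => measurableSet_laguerreCell hΩm hopt.1 _
  have hLΩ : ∀ i, L i ⊆ Ω := fun i => Set.sep_subset _ _
  have hLι : ∀ i, ∀ y ∈ L i, ι y = i := fun i y hy => hι i y hy.2
  have hmass : ∀ i, σ (L i) = (N : ℝ≥0∞)⁻¹ := measure_laguerreCell hιm hmap hcell
  have hmass0 : ∀ i, σ (L i) ≠ 0 := fun i => by simp [hmass]
  have hmassr : ∀ i, σ.real (L i) = (N : ℝ)⁻¹ := fun i => by simp [measureReal_def, hmass]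
  refine (W2sq_atomicMeasure_le hΩm hb hσ hopt.1 hιm hmap hcell _).trans
    (ENNReal.ofReal_le_ofReal ?_)
  change ∑ i, ∫ y in L i, (y - cellBarycenter σ (L i)) ^ 2 ∂σ ≤ _
  -- If `Ω` is null, every competitor has infinite entropy and minimality says nothing, but then the
  -- length bound with `H = Ω` already gives variance `0`.
  by_cases h0 : volume Ω = 0
  · have hr : volume.real Ω = 0 := by simp [measureReal_def, h0]
    rw [hr]
    refine (Finset.sum_nonpos fun i _ => ?_).trans_eq (by simp)
    refine (setIntegral_sub_cellBarycenter_sq_le hΩ hb (hL i)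
      (.of_forall fun y hy => hLΩ i hy) (hmass0 i)).trans_eq ?_
    simp [hr]
  · have hfin : Ent Ω σ ≠ ⊤ := hmin.Ent_ne_top hΩm hb h0 hN
    have hac := (absolutelyContinuous_of_Ent_ne_top hfin).1.trans
      Measure.absolutelyContinuous_restrict
    have hatom : NullSingletonClass σ := ⟨fun y => hac (measure_singleton y)⟩
    set H := fun i => essHull σ (L i) with hHdef
    have hH : ∀ i, (H i).OrdConnected := fun i => essHull_ordConnected _ _
    have hHΩ : ∀ i, H i ⊆ Ω := fun i => essHull_subset hΩ (hLΩ i)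
    -- A common point `y` of the hulls would put positive mass of `L i` to its right and of `L j` to
    -- its left, against the ordering with `c = y`. The hulls are thus disjoint everywhere, not just
    -- up to null sets.
    have hlt : ∀ i j, x i < x j → Disjoint (H i) (H j) := fun i j hij =>
      Set.disjoint_left.2 fun y hi hj =>
        (measure_inter_Ici_eq_zero_or hb hσ x hιm
          (fun κ hκ h => integral_sq_le_of_map_eq hb hσ hιm hmap hTι hopt hκ h) hij (hL i) (hL j)
          (hLΩ i) (hLΩ j) (hLι i) (hLι j) y).elim hi.2 hj.1
    have hdisj : Pairwise (Function.onFun Disjoint H) := fun i j hij =>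
      (lt_or_gt_of_ne (hx.ne hij)).elim (hlt i j) fun h => (hlt j i h).symm
    have hLH : ∀ i, ∀ᵐ y ∂σ, y ∈ L i → y ∈ H i := fun i => ae_mem_essHull σ (L i)
    -- Almost every point lies in the cell of its own label, hence in that hull, and so in no other.
    have hHL : ∀ i, ∀ᵐ y ∂σ, y ∈ H i ↔ y ∈ L i := fun i => by
      filter_upwards [ae_all_iff.2 hLH, hcell] with y h1 h2
      refine ⟨fun hy => (h2 i).2 ?_, h1 i⟩
      by_contra hne
      exact Set.disjoint_left.1 (hdisj (Ne.symm hne)) hy (h1 _ ((h2 _).2 rfl))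
    have hV : ∀ i, ∫ y in L i, (y - cellBarycenter σ (L i)) ^ 2 ∂σ ≤
        2 * √ε * volume.real (H i) * (N : ℝ)⁻¹ := fun i => by
      refine le_two_mul_sqrt_mul hε.le measureReal_nonneg (by positivity) ?_ ?_
      · rw [← hmassr i]
        exact setIntegral_sq_le_of_isEntMinimizer hΩ hb hε hmin hopt hfin hιm hmap hTι i (hL i)
          (hLι i) (hH i) (hHΩ i) (hHL i) (hmass0 i)
      · rw [← hmassr i]
        exact setIntegral_sub_cellBarycenter_sq_le (hH i) (hb.subset (hHΩ i)) (hL i) (hLH i)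
          (hmass0 i)
    have hvol : ∑ i, volume.real (H i) ≤ volume.real Ω := by
      rw [← measureReal_biUnion_finset (fun i _ j _ hij => hdisj hij)
        (fun i _ => (hH i).measurableSet) fun i _ => (hb.subset (hHΩ i)).measure_lt_top.ne]
      exact measureReal_mono (Set.iUnion₂_subset fun i _ => hHΩ i) hb.measure_lt_top.ne
    calc ∑ i, ∫ y in L i, (y - cellBarycenter σ (L i)) ^ 2 ∂σ
        ≤ ∑ i, 2 * √ε * volume.real (H i) * (N : ℝ)⁻¹ := Finset.sum_le_sum fun i _ => hV i
      _ = 2 * √ε * (N : ℝ)⁻¹ * ∑ i, volume.real (H i) := by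
        rw [Finset.mul_sum]
        exact Finset.sum_congr rfl fun i _ => by ring
      _ ≤ 2 * √ε * (N : ℝ)⁻¹ * volume.real Ω := by gcongr
      _ = _ := by ring
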